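/- Let $m,n$ be natural numbers, let $\{\omega_{ij}\}_{i\le m,\,j\le n}$ be an orthonormal basis of $\mathbb{R}^{m\times n}$ (for $\langle A,B\rangle=\operatorname{tr}(A^TB)$) such that $\operatorname{Span}\{\omega_{ij}: 1\le i\le m\}=\operatorname{Span}\{e_ie_j^T: 1\le i\le m\}$ for every $j$ (for example $\omega_{ij}=e_ie_j^T$). Let $L_0\in\mathbb{R}^{m\times n}$ have rank $r$, let $L_0=U\Sigma V^T$ be its skinny SVD, and suppose that $L_0$ satisfies the row-space incoherence condition with parameter $\mu$: $$\max_{i,j}\|\omega_{ij}VV^T\|_F^2\le\frac{\mu r}{n},$$ where $VV^T$ is the orthogonal projection onto the row space of $L_0$. Let $0\le d\le n$, let $\delta_1,\dots,\delta_n$ be independent Bernoulli random variables with $\mathbb{P}(\delta_j=1)=d/n$ and $\mathbb{P}(\delta_j=0)=1-d/n$, and let $$[L_0]_l=\sum_{j=1}^n\delta_j\,[L_0]_{:j}\,e_j^T$$ be the matrix of the sampled columns of $L_0$. Let $\delta>0$ and suppose that $$d\ \ge\ 2\mu r\log\frac{r}{\delta}$$ (for $r=0$ the right-hand side is read as $0$).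 Then with probability at least $1-\delta$, $$\operatorname{Range}([L_0]_l)=\operatorname{Range}(L_0).$$ -/

import Mathlib

open MeasureTheory ProbabilityTheory
open scoped Matrix.Norms.Frobenius

/-- The `m * n` matrices `ω i j` are an orthonormal basis of `ℝ^{m × n}` for the inner product
`⟨A, B⟩ = tr (Aᵀ B)`, such that for each `j` the matrices `ω 1 j, …, ω m j` span the same space as
the standard matrices `e₁ eⱼᵀ, …, eₘ eⱼᵀ`. -/
structure IsGeneralBasis {m n : ℕ} (ω : Fin m → Fin n → Matrix (Fin m) (Fin n) ℝ) : Prop where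
  orthonormal : ∀ i j k l,
    Matrix.trace (Matrix.transpose (ω i j) * ω k l) = if i = k ∧ j = l then 1 else 0
  span_eq : ∀ j, Submodule.span ℝ (Set.range fun i => ω i j) =
    Submodule.span ℝ (Set.range fun i => Matrix.single i j (1 : ℝ))

/-- The row space of `L`, as a subspace of Euclidean space. -/
def rowSpace {m n : ℕ} (L : Matrix (Fin m) (Fin n) ℝ) : Submodule ℝ (EuclideanSpace ℝ (Fin n)) :=
  Submodule.span ℝ (Set.range fun i => WithLp.toLp 2 (L i))

/-- The projection `M ↦ M V Vᵀ`, where the columns of `V` are an orthonormal basis of the row space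
of `L`: each row of `M` is projected orthogonally onto the row space of `L`. -/
noncomputable def rowSpaceProj {m n : ℕ} (L M : Matrix (Fin m) (Fin n) ℝ) :
    Matrix (Fin m) (Fin n) ℝ :=
  Matrix.of fun i => ((rowSpace L).starProjection (WithLp.toLp 2 (M i))).ofLp

/-- Row-space incoherence of `L` with parameter `μ` with respect to `ω`
(`‖·‖` is the Frobenius norm). -/
def RowIncoherent {m n : ℕ} (ω : Fin m → Fin n → Matrix (Fin m) (Fin n) ℝ)
    (L : Matrix (Fin m) (Fin n) ℝ) (μ : ℝ) : Prop :=
  ∀ i j, ‖rowSpaceProj L (ω i j)‖ ^ 2 ≤ μ * L.rank / n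

/-- The matrix `∑ⱼ sⱼ L_{:j} eⱼᵀ` of the columns of `L` selected by the indicators `sⱼ`. -/
def selectColumns {m n : ℕ} (L : Matrix (Fin m) (Fin n) ℝ) (s : Fin n → ℝ) :
    Matrix (Fin m) (Fin n) ℝ :=
  ∑ j, s j • Matrix.vecMulVec (L.col j) (Pi.single j 1)

/-! Let `K` be the row space and `S` the set of sampled columns. The sampled columns span the range
as soon as no nonzero vector of `K` vanishes on `S`, so the quantity to control is `k S`, the
dimension of `vanishing K S`. The squared norms of the projections of the basis vectors `e_j` onto
`vanishing K S` sum to `k S`. Each is at most `R = μ r / n` by incoherence, and is zero unless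
adding `j` lowers `k`. Hence the total drop of `k` over all `j` is at least `k S / R`
(`finrank_vanishing_le_mul_sum`). Russo's formula turns this into a differential inequality in the
density `p`, giving `E k ≤ r exp (-p / R)` (`sum_bernoulliWeight_mul_le_exp`). With `p = d / n` the
exponent is `-d / (μ r)`, and Markov's inequality for the integer `k` bounds the failure probability
by `δ`. -/

/-- The probability that the random subset of `ι` which contains each element independently with
probability `p` is equal to `S`. -/
noncomputable def bernoulliWeight {ι : Type*} [Fintype ι] [DecidableEq ι] (p : ℝ) (S : Finset ι) :
    ℝ :=
  ∏ j, if j ∈ S then p else 1 - p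

/-! ### Russo's formula and exponential decay in the density. -/

section Russo

variable {ι : Type*} [Fintype ι] [DecidableEq ι]

lemma bernoulliWeight_nonneg {p : ℝ} (hp : p ∈ Set.Icc (0 : ℝ) 1) (S : Finset ι) :
    0 ≤ bernoulliWeight p S :=
  Finset.prod_nonneg fun j _ => by split_ifs <;> linarith [hp.1, hp.2]

lemma sum_finset_eq_sum_powerset_erase (j : ι) (f : Finset ι → ℝ) :
    ∑ S, f S = ∑ S ∈ (Finset.univ.erase j).powerset, (f S + f (insert j S)) := by
  rw [Finset.sum_add_distrib, ← Finset.sum_powerset_insert (Finset.notMem_erase j _),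
    Finset.insert_erase (Finset.mem_univ j), Finset.powerset_univ]

lemma prod_erase_insert (j : ι) (S : Finset ι) (a b : ℝ) :
    (∏ i ∈ Finset.univ.erase j, if i ∈ insert j S then a else b) =
      ∏ i ∈ Finset.univ.erase j, if i ∈ S then a else b :=
  Finset.prod_congr rfl fun i hi => by simp [Finset.mem_insert, Finset.ne_of_mem_erase hi]

lemma hasDerivAt_bernoulliWeight (S : Finset ι) (p : ℝ) :
    HasDerivAt (fun p => bernoulliWeight p S)
      (∑ j, (∏ i ∈ Finset.univ.erase j, if i ∈ S then p else 1 - p) *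
        if j ∈ S then 1 else -1) p := by
  unfold bernoulliWeight
  refine HasDerivAt.fun_finsetProd (f' := fun j => if j ∈ S then (1 : ℝ) else -1) fun j _ => ?_
  by_cases h : j ∈ S
  · simpa [h] using hasDerivAt_id' p
  · simpa [h] using (hasDerivAt_id' p).const_sub 1

/-- One half of Russo's formula, for a decreasing function. -/
lemma deriv_sum_bernoulliWeight_le {k : Finset ι → ℝ} (hk : ∀ S j, k (insert j S) ≤ k S)
    {p : ℝ} (hp : p ∈ Set.Icc (0 : ℝ) 1) :
    ∑ S, (∑ j, (∏ i ∈ Finset.univ.erase j, if i ∈ S then p else 1 - p) *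
        if j ∈ S then 1 else -1) * k S ≤
      -∑ S, bernoulliWeight p S * ∑ j, (k S - k (insert j S)) := by
  simp_rw [Finset.sum_mul, Finset.mul_sum]
  rw [Finset.sum_comm, Finset.sum_comm (s := (Finset.univ : Finset (Finset ι))),
    ← Finset.sum_neg_distrib]
  refine Finset.sum_le_sum fun j _ => ?_
  rw [sum_finset_eq_sum_powerset_erase j, sum_finset_eq_sum_powerset_erase j,
    ← Finset.sum_neg_distrib]
  refine Finset.sum_le_sum fun S hS => ?_
  have hj : j ∉ S := fun h => Finset.notMem_erase j _ (Finset.mem_powerset.1 hS h)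
  have hw : bernoulliWeight p S =
      (1 - p) * ∏ i ∈ Finset.univ.erase j, if i ∈ S then p else 1 - p := by
    rw [bernoulliWeight, ← Finset.mul_prod_erase _ _ (Finset.mem_univ j), if_neg hj]
  rw [prod_erase_insert, hw, if_neg hj, if_pos (Finset.mem_insert_self j S), Finset.insert_idem]
  have h0 : 0 ≤ ∏ i ∈ Finset.univ.erase j, if i ∈ S then p else 1 - p :=
    Finset.prod_nonneg fun i _ => by split_ifs <;> linarith [hp.1, hp.2]
  -- With `D = k S - k (insert j S)`, the pair `S`, `insert j S` contributes `-D` times the product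
  -- on the left and `-(1 - p) D` times it on the right; the gap is this nonnegative term.
  have h1 := mul_nonneg (mul_nonneg hp.1 h0) (sub_nonneg.2 (hk S j))
  linarith

/-- If adding a random element to `S` decreases `k S` by at least the proportion `c` in total, then
the mean of `k` over random subsets decays exponentially in the density. -/
theorem sum_bernoulliWeight_mul_le_exp {k : Finset ι → ℝ} {c : ℝ}
    (hk : ∀ S j, k (insert j S) ≤ k S) (hc : ∀ S, c * k S ≤ ∑ j, (k S - k (insert j S)))
    {p : ℝ} (hp : p ∈ Set.Icc (0 : ℝ) 1) :
    ∑ S, bernoulliWeight p S * k S ≤ Real.exp (-(c * p)) * k ∅ := by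
  have hg : ∀ q : ℝ, HasDerivAt (fun q => ∑ S, bernoulliWeight q S * k S)
      (∑ S, (∑ j, (∏ i ∈ Finset.univ.erase j, if i ∈ S then q else 1 - q) *
        if j ∈ S then 1 else -1) * k S) q := fun q =>
    HasDerivAt.fun_sum fun S _ => (hasDerivAt_bernoulliWeight S q).mul_const _
  have he : ∀ q : ℝ, HasDerivAt (fun q => Real.exp (c * q)) (Real.exp (c * q) * c) q := fun q => by
    simpa using ((hasDerivAt_id q).const_mul c).exp
  -- Grönwall's argument: the mean has derivative at most `-c` times itself, so the integrating
  -- factor makes it decreasing.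
  have hanti : AntitoneOn (fun q => Real.exp (c * q) * ∑ S, bernoulliWeight q S * k S)
      (Set.Icc 0 1) := by
    refine antitoneOn_of_hasDerivWithinAt_nonpos (convex_Icc 0 1)
      (fun q _ => ((he q).mul (hg q)).continuousAt.continuousWithinAt)
      (fun q _ => ((he q).mul (hg q)).hasDerivWithinAt) fun q hq => ?_
    rw [interior_Icc] at hq
    have hq := Set.Ioo_subset_Icc_self hq
    have h1 := deriv_sum_bernoulliWeight_le hk hq
    have h2 : c * ∑ S, bernoulliWeight q S * k S ≤
        ∑ S, bernoulliWeight q S * ∑ j, (k S - k (insert j S)) := by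
      rw [Finset.mul_sum]
      refine Finset.sum_le_sum fun S _ => ?_
      rw [mul_left_comm]
      exact mul_le_mul_of_nonneg_left (hc S) (bernoulliWeight_nonneg hq S)
    rw [mul_assoc, ← mul_add]
    exact mul_nonpos_of_nonneg_of_nonpos (Real.exp_nonneg _) (by linarith)
  have h := hanti (Set.left_mem_Icc.2 zero_le_one) hp hp.1
  have h0 : ∑ S, bernoulliWeight 0 S * k S = k ∅ := by
    rw [Finset.sum_eq_single ∅]
    · simp [bernoulliWeight]
    · intro S _ hS
      obtain ⟨j, hj⟩ := Finset.nonempty_iff_ne_empty.2 hS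
      rw [bernoulliWeight, Finset.prod_eq_zero (Finset.mem_univ j) (by simp [hj]), zero_mul]
    · simp
  simp only [mul_zero, Real.exp_zero, one_mul, h0] at h
  calc ∑ S, bernoulliWeight p S * k S
      = Real.exp (-(c * p)) * (Real.exp (c * p) * ∑ S, bernoulliWeight p S * k S) := by
        rw [← mul_assoc, ← Real.exp_add]; simp
    _ ≤ _ := mul_le_mul_of_nonneg_left h (Real.exp_nonneg _)

end Russo

/-! ### Dimension drop of the vanishing subspaces. -/

section Projection

variable {n : ℕ}

/-- Both sides are the trace of the projection, computed in the standard basis and in an orthonormal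
basis of `W`. -/
lemma sum_norm_sq_starProjection_single (W : Submodule ℝ (EuclideanSpace ℝ (Fin n))) :
    ∑ j, ‖W.starProjection (EuclideanSpace.single j (1 : ℝ))‖ ^ 2 = Module.finrank ℝ W := by
  have b := stdOrthonormalBasis ℝ W
  have h : ∀ j, ‖W.starProjection (EuclideanSpace.single j (1 : ℝ))‖ ^ 2 =
      ∑ i, ((b i : EuclideanSpace ℝ (Fin n)) j) ^ 2 := fun j => by
    rw [Submodule.starProjection_apply, ← Submodule.coe_norm, ← b.sum_sq_norm_inner_right]
    refine Finset.sum_congr rfl fun i _ => ?_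
    rw [Submodule.coe_inner, ← Submodule.starProjection_apply,
      ← Submodule.inner_starProjection_left_eq_right,
      Submodule.starProjection_eq_self_iff.2 (b i).2]
    simp [EuclideanSpace.inner_single_right]
  simp_rw [h]
  rw [Finset.sum_comm]
  have h1 : ∀ i, ∑ j, ((b i : EuclideanSpace ℝ (Fin n)) j) ^ 2 = 1 := fun i => by
    rw [← EuclideanSpace.real_norm_sq_eq, ← Submodule.coe_norm, b.norm_eq_one, one_pow]
  simp [h1]

/-- The vectors of `K` whose coordinates in `S` vanish. -/
def vanishing (K : Submodule ℝ (EuclideanSpace ℝ (Fin n))) (S : Finset (Fin n)) :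
    Submodule ℝ (EuclideanSpace ℝ (Fin n)) where
  carrier := {w | w ∈ K ∧ ∀ j ∈ S, w j = 0}
  add_mem' := fun ha hb => ⟨K.add_mem ha.1 hb.1, fun j hj => by simp [ha.2 j hj, hb.2 j hj]⟩
  zero_mem' := ⟨K.zero_mem, fun _ _ => rfl⟩
  smul_mem' := fun c _ ha => ⟨K.smul_mem c ha.1, fun j hj => by simp [ha.2 j hj]⟩

lemma mem_vanishing {K : Submodule ℝ (EuclideanSpace ℝ (Fin n))} {S : Finset (Fin n)}
    {w : EuclideanSpace ℝ (Fin n)} : w ∈ vanishing K S ↔ w ∈ K ∧ ∀ j ∈ S, w j = 0 :=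
  Iff.rfl

lemma vanishing_insert_le (K : Submodule ℝ (EuclideanSpace ℝ (Fin n))) (S : Finset (Fin n))
    (j : Fin n) : vanishing K (insert j S) ≤ vanishing K S := fun _ hw =>
  ⟨hw.1, fun i hi => hw.2 i (Finset.mem_insert_of_mem hi)⟩

lemma norm_starProjection_vanishing_le (K : Submodule ℝ (EuclideanSpace ℝ (Fin n)))
    (S : Finset (Fin n)) (x : EuclideanSpace ℝ (Fin n)) :
    ‖(vanishing K S).starProjection x‖ ≤ ‖K.starProjection x‖ := by
  have hle : vanishing K S ≤ K := fun _ hw => hw.1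
  rw [← Submodule.starProjection_comp_starProjection_of_le hle]
  exact Submodule.norm_starProjection_apply_le _ _

/-- If `j` does not lower the dimension, every vector of `vanishing K S` already vanishes at `j`, so
`e_j` projects to zero. Otherwise the drop is at least one and `R` suffices. -/
lemma norm_sq_starProjection_vanishing_le {K : Submodule ℝ (EuclideanSpace ℝ (Fin n))} {R : ℝ}
    (hR : ∀ j, ‖K.starProjection (EuclideanSpace.single j (1 : ℝ))‖ ^ 2 ≤ R)
    (S : Finset (Fin n)) (j : Fin n) :
    ‖(vanishing K S).starProjection (EuclideanSpace.single j (1 : ℝ))‖ ^ 2 ≤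
      R * ((Module.finrank ℝ (vanishing K S) : ℝ) -
        Module.finrank ℝ (vanishing K (insert j S))) := by
  have hR0 : 0 ≤ R := (sq_nonneg _).trans (hR j)
  by_cases h : vanishing K S ≤ vanishing K (insert j S)
  · rw [le_antisymm h (vanishing_insert_le K S j), sub_self, mul_zero]
    have hz : (vanishing K (insert j S)).starProjection (EuclideanSpace.single j (1 : ℝ)) = 0 := by
      rw [Submodule.starProjection_apply_eq_zero_iff, Submodule.mem_orthogonal]
      intro w hw
      simpa [EuclideanSpace.inner_single_right] using hw.2 j (Finset.mem_insert_self j S)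
    simp [hz]
  · have hlt := Submodule.finrank_lt_finrank_of_lt
      (lt_of_le_not_ge (vanishing_insert_le K S j) h)
    have h1 : (1 : ℝ) ≤ (Module.finrank ℝ (vanishing K S) : ℝ) -
        Module.finrank ℝ (vanishing K (insert j S)) := by
      have : (Module.finrank ℝ (vanishing K (insert j S)) : ℝ) + 1 ≤
        Module.finrank ℝ (vanishing K S) := by exact_mod_cast hlt
      linarith
    calc _ ≤ ‖K.starProjection (EuclideanSpace.single j (1 : ℝ))‖ ^ 2 :=
          pow_le_pow_left₀ (norm_nonneg _) (norm_starProjection_vanishing_le K S _) 2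
      _ ≤ R := hR j
      _ ≤ _ := le_mul_of_one_le_right hR0 h1

lemma finrank_vanishing_le_mul_sum {K : Submodule ℝ (EuclideanSpace ℝ (Fin n))} {R : ℝ}
    (hR : ∀ j, ‖K.starProjection (EuclideanSpace.single j (1 : ℝ))‖ ^ 2 ≤ R)
    (S : Finset (Fin n)) :
    (Module.finrank ℝ (vanishing K S) : ℝ) ≤ R * ∑ j, ((Module.finrank ℝ (vanishing K S) : ℝ) -
        Module.finrank ℝ (vanishing K (insert j S))) := by
  rw [← sum_norm_sq_starProjection_single, Finset.mul_sum]
  refine Finset.sum_le_sum fun j _ => ?_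
  -- The earlier rewrite also replaced the dimension on the right; this restores it.
  rw [sum_norm_sq_starProjection_single]
  exact norm_sq_starProjection_vanishing_le hR S j

/-- Markov's inequality: a nonzero subspace has dimension at least one. -/
lemma sum_bernoulliWeight_not_vanishing_eq_bot_le
    {K : Submodule ℝ (EuclideanSpace ℝ (Fin n))}
    {R : ℝ} (hR0 : 0 < R)
    (hR : ∀ j, ‖K.starProjection (EuclideanSpace.single j (1 : ℝ))‖ ^ 2 ≤ R)
    {p : ℝ} (hp : p ∈ Set.Icc (0 : ℝ) 1) (T : Finset (Finset (Fin n)))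
    (hT : ∀ S ∈ T, vanishing K S ≠ ⊥) :
    ∑ S ∈ T, bernoulliWeight p S ≤ Real.exp (-(p / R)) * Module.finrank ℝ K := by
  have h := sum_bernoulliWeight_mul_le_exp
    (k := fun S => (Module.finrank ℝ (vanishing K S) : ℝ)) (c := 1 / R)
    (fun S j => by
      simpa using Submodule.finrank_mono (vanishing_insert_le K S j))
    (fun S => by
      rw [one_div_mul_eq_div, div_le_iff₀' hR0]
      exact finrank_vanishing_le_mul_sum hR S) hp
  have h0 : vanishing K ∅ = K := by ext; simp [mem_vanishing]
  rw [h0, one_div_mul_eq_div] at h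
  refine le_trans ?_ h
  calc ∑ S ∈ T, bernoulliWeight p S
      ≤ ∑ S ∈ T, bernoulliWeight p S * (Module.finrank ℝ (vanishing K S) : ℝ) := by
        refine Finset.sum_le_sum fun S hS => le_mul_of_one_le_right (bernoulliWeight_nonneg hp S) ?_
        exact_mod_cast Submodule.one_le_finrank_iff.2 (hT S hS)
    _ ≤ _ := Finset.sum_le_univ_sum_of_nonneg fun S =>
        mul_nonneg (bernoulliWeight_nonneg hp S) (Nat.cast_nonneg _)

end Projection

/-! ### Incoherence reduced to the standard basis vectors. -/

section Incoherence

variable {m n : ℕ} {ω : Fin m → Fin n → Matrix (Fin m) (Fin n) ℝ}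

lemma IsGeneralBasis.apply_eq_zero (hω : IsGeneralBasis ω) (i : Fin m) {j b : Fin n} (hb : b ≠ j)
    (a : Fin m) : ω i j a b = 0 := by
  have h : ω i j ∈ Submodule.span ℝ (Set.range fun i => Matrix.single i j (1 : ℝ)) :=
    hω.span_eq j ▸ Submodule.subset_span ⟨i, rfl⟩
  generalize ω i j = M at h
  induction h using Submodule.span_induction with
  | mem x hx => obtain ⟨c, rfl⟩ := hx; simp [hb.symm]
  | zero => rfl
  | add x y _ _ hx hy => simp [hx, hy]
  | smul c x _ hx => simp [hx]

lemma IsGeneralBasis.toLp_eq (hω : IsGeneralBasis ω) (i : Fin m) (j : Fin n) (a : Fin m) :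
    WithLp.toLp 2 (ω i j a) = ω i j a j • EuclideanSpace.single j (1 : ℝ) := by
  ext b
  by_cases hb : b = j
  · subst hb; simp
  · simp [hω.apply_eq_zero i hb a, hb]

lemma IsGeneralBasis.sum_sq (hω : IsGeneralBasis ω) (i : Fin m) (j : Fin n) :
    ∑ a, ω i j a j ^ 2 = 1 := by
  have h := hω.orthonormal i j i j
  simp only [Matrix.trace, Matrix.diag, Matrix.mul_apply, Matrix.transpose_apply, and_self,
    if_true] at h
  rw [Finset.sum_eq_single j (fun b _ hb => by simp [hω.apply_eq_zero i hb]) (by simp)] at h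
  simpa [sq] using h

lemma norm_sq_eq_sum_norm_sq_row (M : Matrix (Fin m) (Fin n) ℝ) :
    ‖M‖ ^ 2 = ∑ a, ‖WithLp.toLp 2 (M a)‖ ^ 2 := by
  have h0 : 0 ≤ ∑ i, ∑ j, ‖M i j‖ ^ (2 : ℝ) := by positivity
  rw [Matrix.frobenius_norm_def, ← Real.sqrt_eq_rpow, Real.sq_sqrt h0]
  simp [EuclideanSpace.real_norm_sq_eq]

/-- Only column `j` of `ω i j` is nonzero, and it is a unit vector. Each row is thus a multiple of
`e_j`, and the squared multiples sum to one. -/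
lemma RowIncoherent.norm_sq_starProjection_single_le {L : Matrix (Fin m) (Fin n) ℝ} {μ : ℝ}
    (hμ : RowIncoherent ω L μ) (hω : IsGeneralBasis ω) (i : Fin m) (j : Fin n) :
    ‖(rowSpace L).starProjection (EuclideanSpace.single j (1 : ℝ))‖ ^ 2 ≤ μ * L.rank / n := by
  refine le_trans (le_of_eq ?_) (hμ i j)
  have h : ∀ a, ‖WithLp.toLp 2 (rowSpaceProj L (ω i j) a)‖ ^ 2 = ω i j a j ^ 2 *
      ‖(rowSpace L).starProjection (EuclideanSpace.single j (1 : ℝ))‖ ^ 2 := fun a => by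
    change ‖(rowSpace L).starProjection (WithLp.toLp 2 (ω i j a))‖ ^ 2 = _
    rw [hω.toLp_eq, map_smul, norm_smul, mul_pow, Real.norm_eq_abs, sq_abs]
  rw [norm_sq_eq_sum_norm_sq_row]
  simp_rw [h]
  rw [← Finset.sum_mul, hω.sum_sq, one_mul]

end Incoherence

/-! ### Range of the sampled columns. -/

section Columns

variable {m n : ℕ}

lemma selectColumns_eq_mul_diagonal (L : Matrix (Fin m) (Fin n) ℝ) (s : Fin n → ℝ) :
    selectColumns L s = L * Matrix.diagonal s := by
  ext a b
  simp [selectColumns, Matrix.sum_apply, Matrix.vecMulVec_apply, Pi.single_apply, mul_comm]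

lemma finrank_rowSpace (L : Matrix (Fin m) (Fin n) ℝ) :
    Module.finrank ℝ (rowSpace L) = L.rank := by
  have h : rowSpace L = (Submodule.span ℝ (Set.range L.row)).map
      (WithLp.linearEquiv 2 ℝ (Fin n → ℝ)).symm.toLinearMap := by
    rw [Submodule.map_span, ← Set.range_comp]
    rfl
  rw [h, LinearEquiv.finrank_map_eq, Matrix.rank_eq_finrank_span_row]

lemma toLp_transpose_mulVec_mem_rowSpace (L : Matrix (Fin m) (Fin n) ℝ) (y : Fin m → ℝ) :
    WithLp.toLp 2 (L.transpose.mulVec y) ∈ rowSpace L := by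
  have h : WithLp.toLp 2 (L.transpose.mulVec y) = ∑ i, y i • WithLp.toLp 2 (L i) := by
    ext j
    simp [Matrix.mulVec, dotProduct, mul_comm]
  rw [h]
  exact Submodule.sum_mem _ fun i _ => Submodule.smul_mem _ _ (Submodule.subset_span ⟨i, rfl⟩)

lemma range_selectColumns_le (L : Matrix (Fin m) (Fin n) ℝ) (s : Fin n → ℝ) :
    LinearMap.range (selectColumns L s).mulVecLin ≤ LinearMap.range L.mulVecLin := by
  rw [selectColumns_eq_mul_diagonal, Matrix.mulVecLin_mul]
  exact LinearMap.range_comp_le_range _ _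

/-- If no nonzero vector of the row space vanishes on the selected coordinates, the selected
columns span the column space. -/
theorem range_selectColumns_eq {L : Matrix (Fin m) (Fin n) ℝ} {s : Fin n → ℝ}
    (h : vanishing (rowSpace L) {j | s j ≠ 0} = ⊥) :
    LinearMap.range (selectColumns L s).mulVecLin = LinearMap.range L.mulVecLin := by
  refine Submodule.eq_of_le_of_finrank_le (range_selectColumns_le L s) ?_
  change L.rank ≤ (selectColumns L s).rank
  rw [← Matrix.rank_transpose L, ← Matrix.rank_transpose (selectColumns L s)]
  -- If `y` kills the sampled columns, then `Lᵀ y` lies in the row space and vanishes on the sample,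
  -- hence is zero.
  have hker : LinearMap.ker (selectColumns L s).transpose.mulVecLin ≤
      LinearMap.ker L.transpose.mulVecLin := by
    intro y hy
    rw [LinearMap.mem_ker, Matrix.mulVecLin_apply, selectColumns_eq_mul_diagonal,
      Matrix.transpose_mul, Matrix.diagonal_transpose, ← Matrix.mulVec_mulVec] at hy
    have hmem : WithLp.toLp 2 (L.transpose.mulVec y) ∈ vanishing (rowSpace L) {j | s j ≠ 0} := by
      refine ⟨toLp_transpose_mulVec_mem_rowSpace L y, fun j hj => ?_⟩
      have hj' := congrFun hy j
      rw [Matrix.mulVec_diagonal] at hj'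
      exact (mul_eq_zero.1 hj').resolve_left (by simpa using hj)
    rw [h, Submodule.mem_bot] at hmem
    exact (WithLp.toLp_eq_zero 2).1 hmem
  have h1 := LinearMap.finrank_range_add_finrank_ker (selectColumns L s).transpose.mulVecLin
  have h2 := LinearMap.finrank_range_add_finrank_ker L.transpose.mulVecLin
  have h3 := Submodule.finrank_mono hker
  unfold Matrix.rank
  omega

end Columns

/-! ### Law of the random set of sampled columns. -/

section Sampling

variable {Ω : Type*} [MeasurableSpace Ω] {P : Measure Ω} {n : ℕ} {s : Fin n → Ω → ℝ}
  {p : unitInterval}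

lemma measureReal_support_eq (hs : iIndepFun s P)
    (hlaw : ∀ j, HasLaw (s j) (bernoulliMeasure (1 : ℝ) 0 p) P) (S : Finset (Fin n)) :
    P.real {x | ({j | s j x ≠ 0} : Finset (Fin n)) = S} = bernoulliWeight (p : ℝ) S := by
  let t : Fin n → Set ℝ := fun j => if j ∈ S then {0}ᶜ else {0}
  have ht : ∀ j, MeasurableSet (t j) := fun j => by
    simp only [t]; split_ifs
    · exact (measurableSet_singleton 0).compl
    · exact measurableSet_singleton 0
  have hset : {x | ({j | s j x ≠ 0} : Finset (Fin n)) = S} =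
      ⋂ j ∈ Finset.univ, s j ⁻¹' t j := by
    ext x
    simp only [Set.mem_ofPred_eq, Finset.ext_iff, Finset.mem_filter, Finset.mem_univ, true_and,
      Set.mem_iInter, Set.mem_preimage, forall_const, t]
    refine forall_congr' fun j => ?_
    by_cases hj : j ∈ S <;> simp [hj]
  rw [hset, measureReal_def, hs.measure_inter_preimage_eq_mul _ fun j _ => ht j,
    ENNReal.toReal_prod, bernoulliWeight]
  refine Finset.prod_congr rfl fun j _ => ?_
  rw [← measureReal_def]
  change P.real {x | s j x ∈ t j} = _
  rw [(hlaw j).measureReal_eq (p := (· ∈ t j)) (ht j), Set.ofPred_mem_eq]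
  by_cases hj : j ∈ S
  · rw [bernoulliMeasure_real_apply_of_mem_of_notMem _ (ht j) (by simp [t, hj])
      (by simp [t, hj]), if_pos hj]
  · rw [bernoulliMeasure_real_apply_of_notMem_of_mem _ (ht j) (by simp [t, hj])
      (by simp [t, hj]), if_neg hj]

/-- The probability that the random set of selected columns avoids `T` is at least one minus the
total weight of `T`. -/
lemma one_sub_sum_bernoulliWeight_le [IsProbabilityMeasure P] (hs : iIndepFun s P)
    (hlaw : ∀ j, HasLaw (s j) (bernoulliMeasure (1 : ℝ) 0 p) P) (T : Finset (Finset (Fin n))) :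
    1 - ∑ S ∈ T, bernoulliWeight (p : ℝ) S ≤
      P.real {x | ({j | s j x ≠ 0} : Finset (Fin n)) ∉ T} := by
  have h1 : P.real {x | ({j | s j x ≠ 0} : Finset (Fin n)) ∈ T} ≤
      ∑ S ∈ T, bernoulliWeight (p : ℝ) S := by
    have hset : {x | ({j | s j x ≠ 0} : Finset (Fin n)) ∈ T} =
        ⋃ S ∈ T, {x | ({j | s j x ≠ 0} : Finset (Fin n)) = S} := by
      ext x; simp
    rw [hset]
    exact (measureReal_biUnion_finset_le T _).trans_eq
      (Finset.sum_congr rfl fun S _ => measureReal_support_eq hs hlaw S)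
  have h2 : (1 : ℝ) ≤ P.real {x | ({j | s j x ≠ 0} : Finset (Fin n)) ∈ T} +
      P.real {x | ({j | s j x ≠ 0} : Finset (Fin n)) ∉ T} := by
    have hu : {x | ({j | s j x ≠ 0} : Finset (Fin n)) ∈ T} ∪
        {x | ({j | s j x ≠ 0} : Finset (Fin n)) ∉ T} = Set.univ := by
      ext x; simp [em]
    rw [← probReal_univ (μ := P), ← hu]
    exact measureReal_union_le _ _
  linarith

end Sampling

/-- Half of the assumed lower bound on `d` is enough here; the factor 2 is slack. -/
lemma exp_neg_div_mul_le {r μ d δ : ℝ} (hr : 1 ≤ r) (hμ : 0 < μ) (hδ : 0 < δ) (hδr : δ ≤ r)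
    (hd : 2 * μ * r * Real.log (r / δ) ≤ d) : Real.exp (-(d / (μ * r))) * r ≤ δ := by
  have hr0 : 0 < r := by linarith
  have hlog : 0 ≤ Real.log (r / δ) := Real.log_nonneg ((one_le_div hδ).2 hδr)
  have h : Real.log (r / δ) ≤ d / (μ * r) := by
    rw [le_div_iff₀ (mul_pos hμ hr0)]
    nlinarith [mul_nonneg (mul_pos hμ hr0).le hlog]
  calc Real.exp (-(d / (μ * r))) * r ≤ Real.exp (-Real.log (r / δ)) * r := by gcongr
    _ = δ := by
      rw [Real.exp_neg, Real.exp_log (div_pos hr0 hδ), inv_div, div_mul_cancel₀ _ hr0.ne']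

theorem theorem2 {m n : ℕ} (L₀ : Matrix (Fin m) (Fin n) ℝ)
    (ω : Fin m → Fin n → Matrix (Fin m) (Fin n) ℝ) (hω : IsGeneralBasis ω)
    (μ : ℝ) (hμ : RowIncoherent ω L₀ μ)
    (d : ℝ) (hd₀ : 0 ≤ d) (hdn : d ≤ n)
    (δ : ℝ) (hδ : 0 < δ)
    (hd : 2 * μ * L₀.rank * Real.log (L₀.rank / δ) ≤ d)
    {Ω : Type*} [MeasurableSpace Ω] (P : Measure Ω) [IsProbabilityMeasure P]
    (s : Fin n → Ω → ℝ) (hs : iIndepFun s P)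
    (hlaw : ∀ j, HasLaw (s j)
      (bernoulliMeasure (1 : ℝ) 0 ⟨d / n, unitInterval.div_mem hd₀ n.cast_nonneg hdn⟩) P) :
    1 - δ ≤ P.real {x | LinearMap.range (selectColumns L₀ fun j => s j x).mulVecLin =
      LinearMap.range L₀.mulVecLin} := by
  classical
  let T : Finset (Finset (Fin n)) := {S | vanishing (rowSpace L₀) S ≠ ⊥}
  have hgood : 1 - ∑ S ∈ T, bernoulliWeight (d / n) S ≤
      P.real {x | LinearMap.range (selectColumns L₀ fun j => s j x).mulVecLin =
        LinearMap.range L₀.mulVecLin} :=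
    (one_sub_sum_bernoulliWeight_le hs hlaw T).trans <| measureReal_mono fun x hx =>
      range_selectColumns_eq (by simpa [T] using hx)
  refine le_trans (sub_le_sub_left ?_ 1) hgood
  have hp : d / n ∈ Set.Icc (0 : ℝ) 1 := unitInterval.div_mem hd₀ n.cast_nonneg hdn
  rcases Nat.eq_zero_or_pos L₀.rank with h0 | hpos
  · have hK : rowSpace L₀ = ⊥ := Submodule.finrank_eq_zero.1 ((finrank_rowSpace L₀).trans h0)
    have hT : T = ∅ := by
      refine Finset.filter_eq_empty_iff.2 fun S _ h => h (eq_bot_iff.2 fun w hw => ?_)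
      exact hK ▸ hw.1
    simpa [hT] using hδ.le
  have hm : 0 < m := hpos.trans_le L₀.rank_le_height
  have hn : 0 < n := hpos.trans_le L₀.rank_le_width
  have hr : (1 : ℝ) ≤ L₀.rank := by exact_mod_cast hpos
  have hn0 : (0 : ℝ) < n := by exact_mod_cast hn
  have hR := hμ.norm_sq_starProjection_single_le hω ⟨0, hm⟩
  -- Summing the incoherence bound over `j` gives `r ≤ μ r` with `r ≥ 1`.
  have hμ0 : 0 < μ := by
    have h := sum_norm_sq_starProjection_single (rowSpace L₀)
    rw [finrank_rowSpace] at h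
    have h' := Finset.sum_le_sum fun j (_ : j ∈ Finset.univ) => hR j
    rw [h, Finset.sum_const, Finset.card_univ, Fintype.card_fin, nsmul_eq_mul,
      mul_div_cancel₀ _ hn0.ne'] at h'
    by_contra hneg
    nlinarith
  by_cases hδr : δ ≤ L₀.rank
  · have h := sum_bernoulliWeight_not_vanishing_eq_bot_le (by positivity) hR hp T
      fun S hS => (Finset.mem_filter.1 hS).2
    rw [finrank_rowSpace, div_div_div_cancel_right₀ hn0.ne'] at h
    exact h.trans (exp_neg_div_mul_le hr hμ0 hδ hδr hd)
  -- For `δ > r` the logarithm is negative, but the trivial bound `E k ≤ r` already suffices.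
  · have h := sum_bernoulliWeight_not_vanishing_eq_bot_le (by positivity) hR hp T
      fun S hS => (Finset.mem_filter.1 hS).2
    rw [finrank_rowSpace] at h
    refine h.trans ((mul_le_of_le_one_left (by positivity) (Real.exp_le_one_iff.2 ?_)).trans
      (not_le.1 hδr).le)
    exact neg_nonpos.2 (div_nonneg hp.1 (by positivity))
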